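/- An anti-lecture hall composition is an infinite sequence $\lambda=(\lambda_1,\lambda_2,\ldots)$ of nonnegative integers with only finitely many nonzero entries such that \[\frac{\lambda_1}{1}\ge\frac{\lambda_2}{2}\ge\frac{\lambda_3}{3}\ge\cdots\ge 0 .\] For integers $m,n\ge 0$ let $F_m(n)$ be the set of anti-lecture hall compositions $\lambda$ with $\lambda_1+\lambda_2+\cdots=n$ and $\lambda_1\le m$. Write $(a;q)_n=\prod_{i=0}^{n-1}(1-aq^i)$. Theorem. Let $k\ge 2$. Then every set $F_{2k-2}(n)$ is finite, and, as an identity of formal power series in $q$, \[ \sum_{n=0}^{\infty}|F_{2k-2}(n)|\,q^n =\sum_{N_1\ge N_2\ge\cdots\ge N_{k-1}\ge 0} \frac{q^{N_1(N_1+1)/2+N_2^2+\cdots+N_{k-1}^2+N_2+\cdots+N_{k-1}}\,(-q;q)_{N_1}} {(q;q)_{N_1-N_2}\cdots(q;q)_{N_{k-2}-N_{k-1}}\,(q;q)_{N_{k-1}}}, \] where the sum on the right, over all integer tuples $(N_1,\ldots,N_{k-1})$ as indicated, converges coefficientwise. -/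

import Mathlib

namespace AntiLectureHall

open PowerSeries

/-- The finite `q`-Pochhammer symbol `(a; q)_n = (1 - a) (1 - a q) ⋯ (1 - a q ^ (n - 1))`. -/
def qPoch {R : Type*} [CommRing R] (a q : R) (n : ℕ) : R :=
  ∏ i ∈ Finset.range n, (1 - a * q ^ i)

/-- `lam` is an anti-lecture hall composition
`λ₁ / 1 ≥ λ₂ / 2 ≥ λ₃ / 3 ≥ ⋯ ≥ 0` with nonnegative integer entries, written as an infinite
vector ending with zeros. The entry `λ_j` is `lam (j - 1)`. -/
def IsAntiLectureHall (lam : ℕ →₀ ℕ) : Prop :=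
  ∀ i : ℕ, (lam (i + 1) : ℚ) / ((i : ℚ) + 2) ≤ (lam i : ℚ) / ((i : ℚ) + 1)

/-- `F m n`: the anti-lecture hall compositions `λ` of `n` (that is, `λ₁ + λ₂ + ⋯ = n`) with
first entry `λ₁ ≤ m`. -/
def F (m n : ℕ) : Set (ℕ →₀ ℕ) :=
  {lam | IsAntiLectureHall lam ∧ (lam.sum fun _ a => a) = n ∧ lam 0 ≤ m}

/-- The entry `N_i` (with `1 ≤ i ≤ k - 1`) of a tuple `(N_1, …, N_{k-1})`, extended by zero to
all other indices; in particular `N_k = 0`. -/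
def entry {k : ℕ} (N : Fin (k - 1) → ℕ) (i : ℕ) : ℕ :=
  if h : 1 ≤ i ∧ i ≤ k - 1 then N ⟨i - 1, by omega⟩ else 0

/-- The formal power series in `q = X`
`q^(N_1(N_1+1)/2 + N_2^2 + ⋯ + N_{k-1}^2 + N_2 + ⋯ + N_{k-1}) (-q; q)_{N_1}` divided by
`(q; q)_{N_1 - N_2} ⋯ (q; q)_{N_{k-2} - N_{k-1}} (q; q)_{N_{k-1}}`.
The last factor of the denominator is the one with `i = k - 1`, because `N_k = 0`. The
denominator has constant term `1`, so its inverse is a true inverse. -/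
noncomputable def summand {k : ℕ} (N : Fin (k - 1) → ℕ) : ℚ⟦X⟧ :=
  X ^ (entry N 1 * (entry N 1 + 1) / 2
      + ∑ i ∈ Finset.Icc 2 (k - 1), (entry N i) ^ 2 + ∑ i ∈ Finset.Icc 2 (k - 1), entry N i)
    * qPoch (-X) X (entry N 1)
    * (∏ i ∈ Finset.Icc 1 (k - 1), qPoch (X : ℚ⟦X⟧) X (entry N i - entry N (i + 1)))⁻¹

end AntiLectureHall

open scoped PowerSeries.WithPiTopology

namespace AntiLectureHall

open PowerSeries

/-! ### Pochhammer symbols, triangular numbers, Gaussian binomials. -/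

section QSeries

variable {R : Type*} [CommRing R]

/-! Let `C_m(N)` count, by weight, the compositions of length `N` with first entry at most `m`. In
such a composition for `m + 1`, the entries with `λ_j ≥ j` form a prefix of some length `M`.
Subtracting `1, …, M` from it leaves a composition for `m`; the tail is a partition in an `(N - M) ×
M` box. Hence `C_{m+1}(N) = ∑_M q^{tri M} [N, M] C_m(M)` (`comp_succ_left`, `seqGF_comp`). Two such
steps collapse into one, by trinomial revision and the `q`-binomial theorem, so `C_{2j+1}(N)` is
`(-q;q)_N` times a `j`-fold sum with weights `q^{M^2+M}` (`compGF_odd`). One further step with `N →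
∞`, where `[N, M]` tends to `1/(q;q)_M`, gives the right-hand side for `k = j + 2`. Since a
composition of `n` has at most `n` nonzero entries, `N = n` already gives the coefficient of `q^n`.
-/

lemma qPoch_zero (a q : R) : qPoch a q 0 = 1 := by simp [qPoch]

lemma qPoch_succ (a q : R) (n : ℕ) : qPoch a q (n + 1) = qPoch a q n * (1 - a * q ^ n) :=
  Finset.prod_range_succ _ _

lemma qPoch_add (a q : R) (m n : ℕ) :
    qPoch a q (m + n) = qPoch a q m * qPoch (a * q ^ m) q n := by
  simp only [qPoch, Finset.prod_range_add, pow_add, mul_assoc]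

lemma dvd_qPoch_sub_one (a q : R) (n : ℕ) : a ∣ qPoch a q n - 1 := by
  induction n with
  | zero => simp [qPoch_zero]
  | succ n ih =>
    have h : qPoch a q (n + 1) - 1 = (qPoch a q n - 1) - a * (qPoch a q n * q ^ n) := by
      rw [qPoch_succ]; ring
    rw [h]
    exact dvd_sub ih (dvd_mul_right _ _)

/-- The triangular number `n (n + 1) / 2`. -/
def tri (n : ℕ) : ℕ := n * (n + 1) / 2

lemma tri_zero : tri 0 = 0 := rfl

lemma tri_eq_sum (n : ℕ) : tri n = ∑ i ∈ Finset.range n, (i + 1) := by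
  have h := Finset.sum_range_id_mul_two (n + 1)
  rw [Finset.sum_range_succ'] at h
  simp only [add_zero, Nat.add_sub_cancel] at h
  rw [tri, mul_comm n, ← h, Nat.mul_div_cancel _ two_pos]

lemma tri_succ (n : ℕ) : tri (n + 1) = tri n + (n + 1) := by
  simp only [tri_eq_sum, Finset.sum_range_succ]

lemma tri_add (m n : ℕ) : tri (m + n) = tri m + m * n + tri n := by
  induction n with
  | zero => simp [tri_zero]
  | succ n ih => rw [← add_assoc, tri_succ, ih, tri_succ]; ring

lemma le_tri (n : ℕ) : n ≤ tri n := by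
  induction n with
  | zero => simp
  | succ n ih => rw [tri_succ]; omega

lemma two_mul_tri (n : ℕ) : 2 * tri n = n ^ 2 + n := by
  induction n with
  | zero => simp [tri_zero]
  | succ n ih => rw [tri_succ, mul_add, ih]; ring

/-- The Gaussian binomial coefficient, by its Pascal recursion. -/
def gauss (q : R) : ℕ → ℕ → R
  | _, 0 => 1
  | 0, _ + 1 => 0
  | n + 1, k + 1 => gauss q n k + q ^ (k + 1) * gauss q n (k + 1)

variable (q : R)

@[simp] lemma gauss_zero_right (n : ℕ) : gauss q n 0 = 1 := by cases n <;> rfl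

lemma gauss_succ_succ (n k : ℕ) :
    gauss q (n + 1) (k + 1) = gauss q n k + q ^ (k + 1) * gauss q n (k + 1) := rfl

lemma gauss_eq_zero {n k : ℕ} (h : n < k) : gauss q n k = 0 := by
  induction n generalizing k with
  | zero => obtain ⟨k, rfl⟩ := Nat.exists_eq_succ_of_ne_zero h.ne'; rfl
  | succ n ih =>
    obtain ⟨k, rfl⟩ := Nat.exists_eq_succ_of_ne_zero (Nat.ne_zero_of_lt h)
    rw [Nat.succ_eq_add_one, gauss_succ_succ, ih (by omega), ih (by omega)]; simp

@[simp] lemma gauss_self (n : ℕ) : gauss q n n = 1 := by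
  induction n with
  | zero => rfl
  | succ n ih => rw [gauss_succ_succ, ih, gauss_eq_zero q n.lt_succ_self]; simp

lemma gauss_mul_qPoch (a b : ℕ) :
    gauss q (a + b) b * (qPoch q q a * qPoch q q b) = qPoch q q (a + b) := by
  induction a generalizing b with
  | zero => simp [qPoch_zero]
  | succ a iha =>
    induction b with
    | zero => simp [qPoch_zero]
    | succ b ihb =>
      have h1 := iha (b + 1)
      rw [← add_assoc, qPoch_succ, qPoch_succ] at h1
      rw [show a + 1 + b = a + b + 1 by ring, qPoch_succ, qPoch_succ] at ihb
      rw [show a + 1 + (b + 1) = a + b + 1 + 1 by ring, gauss_succ_succ, qPoch_succ, qPoch_succ,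
        qPoch_succ, qPoch_succ]
      linear_combination (1 - q * q ^ b) * ihb + q ^ (b + 1) * (1 - q * q ^ a) * h1

/-- The finite `q`-binomial theorem. -/
lemma sum_gauss (n : ℕ) (z : R) :
    ∑ k ∈ Finset.range (n + 1), q ^ tri k * z ^ k * gauss q n k = qPoch (-(z * q)) q n := by
  induction n generalizing z with
  | zero => simp [tri_zero, qPoch_zero]
  | succ n ih =>
    -- Splitting off the first factor, not the last, shifts `z` to `z * q`; hence the induction over
    -- all `z`.
    have key : qPoch (-(z * q)) q (n + 1) = (1 + z * q) * qPoch (-(z * q * q)) q n := by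
      rw [add_comm n 1, qPoch_add, qPoch_succ, qPoch_zero]
      congr 1 <;> ring_nf
    rw [key, ← ih, Finset.sum_range_succ', add_mul, one_mul,
      Finset.sum_congr rfl (g := fun k =>
        q ^ tri (k + 1) * (z * q) ^ (k + 1) * gauss q n (k + 1) +
          z * q * (q ^ tri k * (z * q) ^ k * gauss q n k))
        (fun k _ => by rw [gauss_succ_succ, tri_succ]; ring),
      Finset.sum_add_distrib, ← Finset.mul_sum]
    have h2 := Finset.sum_range_succ' (fun k => q ^ tri k * (z * q) ^ k * gauss q n k) (n + 1)
    rw [Finset.sum_range_succ, gauss_eq_zero q n.lt_succ_self] at h2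
    simp only [tri_zero, pow_zero, gauss_zero_right, mul_one, mul_zero, add_zero] at h2 ⊢
    linear_combination -h2

end QSeries

lemma constantCoeff_qPoch_X (n : ℕ) : constantCoeff (qPoch (X : ℚ⟦X⟧) X n) = 1 := by
  induction n with
  | zero => simp [qPoch_zero]
  | succ n ih => simp [qPoch_succ, ih]

lemma qPoch_X_mul_inv (n : ℕ) : qPoch (X : ℚ⟦X⟧) X n * (qPoch (X : ℚ⟦X⟧) X n)⁻¹ = 1 :=
  PowerSeries.mul_inv_cancel _ (by simp [constantCoeff_qPoch_X])

lemma gauss_X_eq {n k : ℕ} (h : k ≤ n) :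
    gauss (X : ℚ⟦X⟧) n k =
      qPoch X X n * (qPoch (X : ℚ⟦X⟧) X (n - k))⁻¹ * (qPoch (X : ℚ⟦X⟧) X k)⁻¹ := by
  obtain ⟨a, rfl⟩ := Nat.exists_eq_add_of_le' h
  rw [Nat.add_sub_cancel, ← gauss_mul_qPoch]
  linear_combination -gauss (X : ℚ⟦X⟧) (a + k) k * qPoch_X_mul_inv a -
    gauss (X : ℚ⟦X⟧) (a + k) k * qPoch X X a * (qPoch (X : ℚ⟦X⟧) X a)⁻¹ * qPoch_X_mul_inv k

/-- Trinomial revision for Gaussian binomial coefficients. -/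
lemma gauss_mul_gauss {n m l : ℕ} (hm : m ≤ n) (hl : l ≤ m) :
    gauss (X : ℚ⟦X⟧) n m * gauss X m l = gauss X n l * gauss X (n - l) (m - l) := by
  rw [gauss_X_eq hm, gauss_X_eq hl, gauss_X_eq (hl.trans hm), gauss_X_eq (by omega),
    show n - l - (m - l) = n - m by omega]
  have e1 := qPoch_X_mul_inv m
  have e2 := qPoch_X_mul_inv (n - l)
  set u := (qPoch (X : ℚ⟦X⟧) X (n - m))⁻¹
  set v := (qPoch (X : ℚ⟦X⟧) X (m - l))⁻¹
  set w := (qPoch (X : ℚ⟦X⟧) X l)⁻¹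
  linear_combination qPoch X X n * u * v * w * (e1 - e2)

/-! ### The recursion in `m`, its two-step collapse and its limit. -/

/-- The generating function of anti-lecture hall compositions of length `N` with first entry at
most `m`, as produced by its recursion on `m`. -/
noncomputable def compGF : ℕ → ℕ → ℚ⟦X⟧
  | 0, _ => 1
  | m + 1, N => ∑ M ∈ Finset.range (N + 1), X ^ tri M * gauss X N M * compGF m M

/-- Normalized inner multiple sum of the right-hand side. -/
noncomputable def innerSum : ℕ → ℕ → ℚ⟦X⟧
  | 0, _ => 1
  | j + 1, N => ∑ M ∈ Finset.range (N + 1), X ^ (2 * tri M) * gauss X N M * innerSum j M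

lemma compGF_succ (m N : ℕ) : compGF (m + 1) N =
    ∑ M ∈ Finset.range (N + 1), X ^ tri M * gauss X N M * compGF m M := rfl

lemma innerSum_succ (j N : ℕ) : innerSum (j + 1) N =
    ∑ M ∈ Finset.range (N + 1), X ^ (2 * tri M) * gauss X N M * innerSum j M := rfl

/-- Trinomial revision frees `gauss X N L` from the sum; with `M = L + t`, the cross term `L * t` of
`tri (L + t)` makes the rest a `q`-binomial sum at `z = X ^ L`. -/
lemma sum_gauss_mul_gauss {N L : ℕ} (hL : L ≤ N) :
    ∑ M ∈ Finset.Ico L (N + 1), X ^ tri M * gauss (X : ℚ⟦X⟧) N M * gauss X M L =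
      X ^ tri L * gauss X N L * qPoch (-(X ^ L * X)) X (N - L) := by
  rw [← sum_gauss, Finset.mul_sum, Finset.sum_Ico_eq_sum_range,
    show N + 1 - L = N - L + 1 by omega]
  refine Finset.sum_congr rfl fun t ht => ?_
  have ht' : t ≤ N - L := Nat.lt_succ_iff.mp (Finset.mem_range.mp ht)
  have := gauss_mul_gauss (n := N) (m := L + t) (l := L) (by omega) (by omega)
  rw [Nat.add_sub_cancel_left] at this
  rw [mul_assoc, this, tri_add, pow_add, pow_add, pow_mul]
  ring

/-- Two steps of the recursion for `compGF` amount to one step of that for `innerSum`. -/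
lemma compGF_odd (j N : ℕ) : compGF (2 * j + 1) N = qPoch (-X) X N * innerSum j N := by
  induction j generalizing N with
  | zero =>
    have := sum_gauss (X : ℚ⟦X⟧) N 1
    simp only [one_pow, mul_one, one_mul] at this
    simp [compGF, innerSum, this]
  | succ j ih =>
    rw [show 2 * (j + 1) + 1 = (2 * j + 1) + 1 + 1 by ring, compGF_succ]
    simp only [compGF_succ (2 * j + 1), ih, innerSum_succ, Finset.mul_sum]
    rw [Finset.sum_comm' (t' := Finset.range (N + 1)) (s' := fun L => Finset.Ico L (N + 1))
      (by intro M L; simp only [Finset.mem_Ico, Finset.mem_range]; omega)]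
    refine Finset.sum_congr rfl fun L hL => ?_
    have hL' : L ≤ N := Nat.lt_succ_iff.mp (Finset.mem_range.mp hL)
    have h1 := sum_gauss_mul_gauss hL'
    -- The factor from the sum over `M` completes `(-q;q)_L` to `(-q;q)_N`, which no longer depends
    -- on `L`.
    have h2 := qPoch_add (-X : ℚ⟦X⟧) X L (N - L)
    rw [Nat.add_sub_cancel' hL', show (-X : ℚ⟦X⟧) * X ^ L = -(X ^ L * X) by ring] at h2
    rw [h2, Finset.sum_congr rfl (g := fun M => X ^ tri M * gauss (X : ℚ⟦X⟧) N M * gauss X M L *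
      (X ^ tri L * qPoch (-X) X L * innerSum j L)) (fun M _ => by ring), ← Finset.sum_mul, h1]
    ring

/-- Up to degree `N`, a Gaussian binomial coefficient may be replaced by its limit. -/
lemma X_pow_dvd_gauss_sub {N M : ℕ} (h : M ≤ N) :
    (X : ℚ⟦X⟧) ^ (N + 1) ∣ X ^ tri M * (gauss X N M - (qPoch X X M)⁻¹) := by
  rcases M.eq_zero_or_pos with rfl | hM
  · simp [qPoch_zero]
  have h1 := qPoch_add (X : ℚ⟦X⟧) X (N - M) M
  rw [Nat.sub_add_cancel h, ← pow_succ'] at h1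
  obtain ⟨c, hc⟩ := dvd_qPoch_sub_one ((X : ℚ⟦X⟧) ^ (N - M + 1)) X M
  have h2 : gauss (X : ℚ⟦X⟧) N M - (qPoch X X M)⁻¹ =
      X ^ (N - M + 1) * (c * (qPoch X X M)⁻¹) := by
    rw [gauss_X_eq h, h1]
    linear_combination (qPoch (X : ℚ⟦X⟧) X M)⁻¹ * hc + qPoch ((X : ℚ⟦X⟧) ^ (N - M + 1)) X M *
      (qPoch (X : ℚ⟦X⟧) X M)⁻¹ * qPoch_X_mul_inv (N - M)
  rw [h2, ← mul_assoc, ← pow_add]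
  exact Dvd.dvd.mul_right (pow_dvd_pow _ (by have := le_tri M; omega)) _

/-- Coefficients of `compGF` of even index stabilize to those of the limiting sum. -/
lemma coeff_compGF_even (j n : ℕ) : coeff n (compGF (2 * j + 2) n) =
    coeff n (∑ M ∈ Finset.range (n + 1),
      X ^ tri M * qPoch (-X) X M * ((qPoch X X M)⁻¹ * innerSum j M)) := by
  rw [← sub_eq_zero, ← map_sub, compGF_succ, ← Finset.sum_sub_distrib]
  refine X_pow_dvd_iff.mp (Finset.dvd_sum fun M hM => ?_) n n.lt_succ_self
  rw [compGF_odd]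
  have h := X_pow_dvd_gauss_sub (Nat.lt_succ_iff.mp (Finset.mem_range.mp hM))
  convert h.mul_right (qPoch (-X) X M * innerSum j M) using 1
  ring

/-! ### Boxed partitions and truncated compositions. -/

lemma finite_bounded (N B : ℕ) : {f : ℕ → ℕ | (∀ i, f i ≤ B) ∧ ∀ i, N ≤ i → f i = 0}.Finite := by
  have hfin : {g : Fin N → ℕ | ∀ i, g i ∈ Set.Iic B}.Finite :=
    Set.Finite.pi' fun _ => Set.finite_Iic B
  refine Set.Finite.of_injOn (f := fun (f : ℕ → ℕ) (i : Fin N) => f i) ?_ ?_ hfin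
  · exact fun f hf i => hf.1 i
  intro f hf g hg h
  funext i
  rcases lt_or_ge i N with hi | hi
  · exact congrFun h ⟨i, hi⟩
  · rw [hf.2 i hi, hg.2 i hi]

/-- Partitions into at most `a` parts, each at most `b`. -/
def box (a b : ℕ) : Set (ℕ → ℕ) := {f | Antitone f ∧ f 0 ≤ b ∧ ∀ i, a ≤ i → f i = 0}

/-- Anti-lecture hall compositions of length `N` with first entry at most `m`. -/
def comp (m N : ℕ) : Set (ℕ → ℕ) :=
  {f | (∀ i, (i + 1) * f (i + 1) ≤ (i + 2) * f i) ∧ f 0 ≤ m ∧ ∀ i, N ≤ i → f i = 0}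

lemma finite_box (a b : ℕ) : (box a b).Finite :=
  (finite_bounded a b).subset fun _ hf => ⟨fun _ => (hf.1 (Nat.zero_le _)).trans hf.2.1, hf.2.2⟩

lemma comp_le {m N : ℕ} {f : ℕ → ℕ} (hf : f ∈ comp m N) (i : ℕ) : f i ≤ (i + 1) * m := by
  induction i with
  | zero => simpa using hf.2.1
  | succ i ih =>
    refine Nat.le_of_mul_le_mul_left ((hf.1 i).trans ?_) i.succ_pos
    calc (i + 2) * f i ≤ (i + 2) * ((i + 1) * m) := Nat.mul_le_mul_left _ ih
      _ = _ := by ring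

lemma finite_comp (m N : ℕ) : (comp m N).Finite := by
  refine (finite_bounded N (N * m)).subset fun f hf => ⟨fun i => ?_, hf.2.2⟩
  rcases lt_or_ge i N with hi | hi
  · exact (comp_le hf i).trans (Nat.mul_le_mul_right _ hi)
  · simp [hf.2.2 i hi]

lemma box_zero_left (b : ℕ) : box 0 b = {0} := by
  ext f
  refine ⟨fun h => funext fun i => h.2.2 i i.zero_le, ?_⟩
  rintro rfl
  exact ⟨antitone_const, Nat.zero_le _, fun _ _ => rfl⟩

lemma box_zero_right (a : ℕ) : box a 0 = {0} := by
  ext f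
  refine ⟨fun h => funext fun i => Nat.le_zero.mp ((h.1 i.zero_le).trans h.2.1), ?_⟩
  rintro rfl
  exact ⟨antitone_const, Nat.zero_le _, fun _ _ => rfl⟩

lemma comp_zero_left (N : ℕ) : comp 0 N = {0} := by
  ext f
  refine ⟨fun h => funext fun i => by simpa using comp_le h i, ?_⟩
  rintro rfl
  exact ⟨by simp, le_rfl, fun _ _ => rfl⟩

/-- Prepend a value to a sequence. -/
def consSeq (b : ℕ) (f : ℕ → ℕ) : ℕ → ℕ
  | 0 => b
  | i + 1 => f i

lemma consSeq_injective (b : ℕ) : Function.Injective (consSeq b) :=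
  fun _ _ h => funext fun i => congrFun h (i + 1)

/-- Whether the largest part attains `b + 1` decides the case; this is the Pascal recursion of
`gauss`. -/
lemma box_succ_succ (a b : ℕ) :
    box (a + 1) (b + 1) = box (a + 1) b ∪ consSeq (b + 1) '' box a (b + 1) := by
  ext f
  constructor
  · rintro ⟨h1, h2, h3⟩
    rcases Nat.le_succ_iff.mp h2 with h | h
    · exact Or.inl ⟨h1, h, h3⟩
    · refine Or.inr ⟨fun i => f (i + 1), ⟨fun x y hxy => h1 (by omega),
        (h1 (Nat.zero_le _)).trans h2, fun i hi => h3 _ (by omega)⟩, ?_⟩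
      funext i
      cases i with
      | zero => exact h.symm
      | succ i => rfl
  · rintro (⟨h1, h2, h3⟩ | ⟨g, ⟨h1, h2, h3⟩, rfl⟩)
    · exact ⟨h1, h2.trans b.le_succ, h3⟩
    · refine ⟨antitone_nat_of_succ_le fun i => ?_, le_rfl, fun i hi => ?_⟩
      · cases i with
        | zero => exact h2
        | succ i => exact h1 i.le_succ
      · obtain ⟨i, rfl⟩ := Nat.exists_eq_add_of_le' (show 1 ≤ i by omega)
        exact h3 i (by omega)

/-- Generating function of a set of sequences by the sum of the first `n` entries. -/
noncomputable def seqGF (n : ℕ) (A : Set (ℕ → ℕ)) : ℚ⟦X⟧ :=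
  ∑ᶠ f ∈ A, X ^ ∑ i ∈ Finset.range n, f i

lemma seqGF_singleton_zero (n : ℕ) : seqGF n {0} = 1 := by
  simp [seqGF]

lemma seqGF_box (a b : ℕ) : seqGF a (box a b) = gauss X (a + b) b := by
  induction a generalizing b with
  | zero => simp [box_zero_left, seqGF_singleton_zero]
  | succ a iha =>
    induction b with
    | zero => simp [box_zero_right, seqGF_singleton_zero]
    | succ b ihb =>
      have hd : Disjoint (box (a + 1) b) (consSeq (b + 1) '' box a (b + 1)) := by
        rw [Set.disjoint_left]
        rintro _ ⟨-, h, -⟩ ⟨g, -, rfl⟩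
        exact absurd h (Nat.not_succ_le_self b)
      rw [seqGF, box_succ_succ, finsum_mem_union hd (finite_box _ _) ((finite_box _ _).image _),
        finsum_mem_image (consSeq_injective _).injOn, show a + 1 + (b + 1) = a + b + 1 + 1 by ring,
        gauss_succ_succ, show a + b + 1 = a + 1 + b by ring, ← ihb,
        show a + 1 + b = a + (b + 1) by ring, ← iha, seqGF, seqGF,
        finsum_mem_eq_finite_toFinset_sum _ (finite_box a (b + 1)),
        finsum_mem_eq_finite_toFinset_sum _ (finite_box a (b + 1)), Finset.mul_sum]
      congr 1
      refine Finset.sum_congr rfl fun f _ => ?_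
      rw [Finset.sum_range_succ', add_comm, pow_add]
      rfl

/-! ### Cutting a composition where its entries drop below their positions. -/

/-- Raise the first `M` entries of `g` by `1, 2, …, M` and continue with `h`. -/
def glue (M : ℕ) (p : (ℕ → ℕ) × (ℕ → ℕ)) (i : ℕ) : ℕ :=
  if i < M then p.1 i + (i + 1) else p.2 (i - M)

lemma glue_mem_comp {m N M : ℕ} (hM : M ≤ N) {p : (ℕ → ℕ) × (ℕ → ℕ)}
    (hg : p.1 ∈ comp m M) (hh : p.2 ∈ box (N - M) M) : glue M p ∈ comp (m + 1) N := by
  obtain ⟨g, h⟩ := p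
  obtain ⟨g1, g2, g3⟩ := hg
  obtain ⟨h1, h2, h3⟩ := hh
  dsimp only at *
  refine ⟨fun i => ?_, ?_, fun i hi => ?_⟩
  · rcases lt_trichotomy (i + 1) M with hi | hi | hi
    · simp only [glue, if_pos hi, if_pos (show i < M by omega)]
      linarith [g1 i]
    · subst hi
      simp only [glue, lt_irrefl, if_false, if_pos i.lt_succ_self, Nat.sub_self]
      nlinarith
    · simp only [glue, if_neg hi.not_gt, if_neg (show ¬ i < M by omega)]
      exact Nat.mul_le_mul (by omega) (h1 (by omega))
  · rcases M.eq_zero_or_pos with rfl | hM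
    · simp only [glue, lt_irrefl, if_false, Nat.sub_self]; omega
    · simp only [glue, if_pos hM]; omega
  · simp only [glue, if_neg (show ¬ i < M by omega)]
    exact h3 _ (by omega)

lemma sum_glue {N M : ℕ} (hM : M ≤ N) (p : (ℕ → ℕ) × (ℕ → ℕ)) :
    ∑ i ∈ Finset.range N, glue M p i =
      tri M + ∑ i ∈ Finset.range (N - M), p.2 i + ∑ i ∈ Finset.range M, p.1 i := by
  obtain ⟨a, rfl⟩ := Nat.exists_eq_add_of_le hM
  rw [Finset.sum_range_add, Nat.add_sub_cancel_left, tri_eq_sum,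
    Finset.sum_congr (f := glue M p) rfl (g := fun i => p.1 i + (i + 1))
      (fun i hi => if_pos (Finset.mem_range.mp hi)), Finset.sum_add_distrib]
  simp only [glue, Nat.not_lt.mpr (Nat.le_add_right M _), if_false, Nat.add_sub_cancel_left]
  omega

/-- Characterizes `M` as the first index whose value does not exceed it, so different `M` give
disjoint images. -/
lemma glue_breaks {a M : ℕ} {p : (ℕ → ℕ) × (ℕ → ℕ)} (hh : p.2 ∈ box a M) :
    glue M p M ≤ M ∧ ∀ i < M, i < glue M p i := by
  refine ⟨by simpa [glue] using hh.2.1, fun i hi => ?_⟩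
  simp only [glue, if_pos hi]
  omega

lemma glue_injOn (m a M : ℕ) : Set.InjOn (glue M) (comp m M ×ˢ box a M) := by
  rintro ⟨g, h⟩ ⟨⟨-, -, hg⟩, -⟩ ⟨g', h'⟩ ⟨⟨-, -, hg'⟩, -⟩ e
  refine Prod.ext (funext fun i => ?_) (funext fun i => ?_)
  · rcases lt_or_ge i M with hi | hi
    · simpa [glue, hi] using congrFun e i
    · exact (hg i hi).trans (hg' i hi).symm
  · simpa [glue] using congrFun e (i + M)

lemma exists_glue_eq {m N : ℕ} {f : ℕ → ℕ} (hf : f ∈ comp (m + 1) N) :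
    ∃ M ≤ N, f ∈ glue M '' (comp m M ×ˢ box (N - M) M) := by
  classical
  obtain ⟨f1, f2, f3⟩ := hf
  have hex : ∃ M, f M ≤ M := ⟨N, by simp [f3 N le_rfl]⟩
  set M := Nat.find hex with hMdef
  have hM : f M ≤ M := Nat.find_spec hex
  have hlt : ∀ i < M, i < f i := fun i hi => not_le.mp (Nat.find_min hex hi)
  have hMN : M ≤ N := Nat.find_min' hex (by simp [f3 N le_rfl])
  -- If `f (i + 1) ≥ f i + 1`, the ratio condition forces `i + 1 ≤ f i`. So beyond `M` the sequence
  -- is nonincreasing.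
  have hstep : ∀ i, f i ≤ i → f (i + 1) ≤ f i := fun i hi => by
    have := f1 i
    by_contra! hc
    nlinarith
  have hle : ∀ i, M ≤ i → f i ≤ i := by
    intro i hi
    induction i, hi using Nat.le_induction with
    | base => exact hM
    | succ i _ ih => exact (hstep i ih).trans (by omega)
  refine ⟨M, hMN, ⟨fun i => if i < M then f i - (i + 1) else 0, fun i => f (i + M)⟩,
    ⟨⟨fun i => ?_, ?_, fun i hi => if_neg (by omega)⟩,
      antitone_nat_of_succ_le fun i => ?_, by simpa using hM, fun i hi => f3 _ (by omega)⟩, ?_⟩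
  · by_cases hi : i + 1 < M
    · have a1 := hlt i (by omega)
      have a2 := hlt (i + 1) hi
      simp only [if_pos hi, if_pos (show i < M by omega)]
      zify [show i + 1 ≤ f i from a1, show i + 1 + 1 ≤ f (i + 1) from a2]
      have := f1 i
      zify at this
      linarith
    · simp [if_neg hi]
  · by_cases hi : 0 < M
    · simp only [if_pos hi]; omega
    · simp [if_neg hi]
  · dsimp only
    rw [show i + 1 + M = i + M + 1 by ring]
    exact hstep _ (hle _ (by omega))
  · funext i
    by_cases hi : i < M
    · have := hlt i hi
      simp only [glue, if_pos hi]; omega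
    · simp only [glue, if_neg hi]
      congr 1; omega

lemma comp_succ_left (m N : ℕ) : comp (m + 1) N =
    ⋃ M ∈ Finset.range (N + 1), glue M '' (comp m M ×ˢ box (N - M) M) := by
  ext f
  simp only [Set.mem_iUnion, Finset.mem_range, Nat.lt_succ_iff, exists_prop]
  refine ⟨fun hf => exists_glue_eq hf, ?_⟩
  rintro ⟨M, hM, p, ⟨hg, hh⟩, rfl⟩
  exact glue_mem_comp hM hg hh

lemma seqGF_comp (m N : ℕ) : seqGF N (comp m N) = compGF m N := by
  induction m generalizing N with
  | zero => rw [comp_zero_left, seqGF_singleton_zero]; rfl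
  | succ m ih =>
    have hd : (↑(Finset.range (N + 1)) : Set ℕ).PairwiseDisjoint
        fun M => glue M '' (comp m M ×ˢ box (N - M) M) := by
      intro M _ M' _ hne
      rw [Function.onFun, Set.disjoint_left]
      rintro _ ⟨p, ⟨-, hp⟩, rfl⟩ ⟨p', ⟨-, hp'⟩, e⟩
      have h1 := glue_breaks hp
      have h2 := glue_breaks hp'
      rw [e] at h2
      rcases lt_or_gt_of_ne hne with h | h
      · exact absurd (h2.2 _ h) (not_lt.mpr h1.1)
      · exact absurd (h1.2 _ h) (not_lt.mpr h2.1)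
    have hfin : ∀ M, (comp m M ×ˢ box (N - M) M).Finite :=
      fun M => (finite_comp _ _).prod (finite_box _ _)
    have hU : (⋃ M ∈ Finset.range (N + 1), glue M '' (comp m M ×ˢ box (N - M) M)) =
      ⋃ M ∈ (↑(Finset.range (N + 1)) : Set ℕ), glue M '' (comp m M ×ˢ box (N - M) M) := by
      simp
    rw [seqGF, comp_succ_left, hU, finsum_mem_biUnion hd (Finset.finite_toSet _)
      (fun M _ => (hfin M).image _), finsum_mem_coe_finset, compGF_succ]
    refine Finset.sum_congr rfl fun M hM => ?_
    have hM' : M ≤ N := Nat.lt_succ_iff.mp (Finset.mem_range.mp hM)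
    have hb := seqGF_box (N - M) M
    rw [Nat.sub_add_cancel hM'] at hb
    rw [finsum_mem_image (glue_injOn m (N - M) M), ← ih, ← hb,
      finsum_mem_eq_finite_toFinset_sum _ (hfin M), seqGF, seqGF,
      finsum_mem_eq_finite_toFinset_sum _ (finite_comp _ _),
      finsum_mem_eq_finite_toFinset_sum _ (finite_box _ _), ← Set.Finite.toFinset_prod (finite_comp m M) (finite_box (N - M) M),
      Finset.sum_product, mul_assoc, Finset.sum_mul_sum, Finset.sum_comm, Finset.mul_sum]
    refine Finset.sum_congr rfl fun h _ => ?_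
    rw [Finset.mul_sum]
    refine Finset.sum_congr rfl fun g _ => ?_
    rw [sum_glue hM', pow_add, pow_add, mul_assoc]

lemma coeff_compGF (m n N : ℕ) : coeff n (compGF m N) =
    ({f ∈ comp m N | ∑ i ∈ Finset.range N, f i = n}.ncard : ℚ) := by
  classical
  rw [← seqGF_comp, seqGF, finsum_mem_eq_finite_toFinset_sum _ (finite_comp _ _), map_sum,
    show {f ∈ comp m N | ∑ i ∈ Finset.range N, f i = n} =
      ↑((finite_comp m N).toFinset.filter fun f => ∑ i ∈ Finset.range N, f i = n) by ext; simp,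
    Set.ncard_coe_finset, Finset.card_filter]
  push_cast
  refine Finset.sum_congr rfl fun f _ => ?_
  simp only [coeff_X_pow, eq_comm]

/-! ### From finitely supported compositions of `n` to length `n`. -/

lemma isAntiLectureHall_iff (lam : ℕ →₀ ℕ) :
    IsAntiLectureHall lam ↔ ∀ i, (i + 1) * lam (i + 1) ≤ (i + 2) * lam i := by
  refine forall_congr' fun i => ?_
  rw [div_le_div_iff₀ (by positivity) (by positivity), mul_comm, mul_comm (lam i : ℚ)]
  exact_mod_cast Iff.rfl

/-- Since the nonzero entries form a prefix, the length is at most the weight. -/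
lemma eq_zero_of_sum_le {lam : ℕ →₀ ℕ} (h : IsAntiLectureHall lam) {i : ℕ}
    (hi : (lam.sum fun _ a => a) ≤ i) : lam i = 0 := by
  rw [isAntiLectureHall_iff] at h
  by_contra hne
  have hpre : ∀ j ≤ i, lam j ≠ 0 := by
    intro j hj
    induction hj using Nat.decreasingInduction with
    | self => exact hne
    | of_succ j _ ih =>
      intro h0
      have := h j
      rw [h0] at this
      simp at this
      exact ih this
  have hsub : Finset.range (i + 1) ⊆ lam.support := fun j hj =>
    Finsupp.mem_support_iff.mpr (hpre j (Nat.lt_succ_iff.mp (Finset.mem_range.mp hj)))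
  have h1 : lam.support.card ≤ lam.sum fun _ a => a := by
    rw [Finset.card_eq_sum_ones]
    exact Finset.sum_le_sum fun j hj => Nat.one_le_iff_ne_zero.mpr (Finsupp.mem_support_iff.mp hj)
  have h2 := Finset.card_le_card hsub
  rw [Finset.card_range] at h2
  omega

lemma image_coe_F (m n : ℕ) : (fun lam : ℕ →₀ ℕ => (lam : ℕ → ℕ)) '' F m n =
    {f ∈ comp m n | ∑ i ∈ Finset.range n, f i = n} := by
  have hsum : ∀ lam : ℕ →₀ ℕ, (∀ i, n ≤ i → lam i = 0) →
      (lam.sum fun _ a => a) = ∑ i ∈ Finset.range n, lam i := fun lam h =>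
    Finset.sum_subset (fun i hi => Finset.mem_range.mpr
      (not_le.mp fun hn => Finsupp.mem_support_iff.mp hi (h i hn)))
      fun i _ hi => Finsupp.notMem_support_iff.mp hi
  ext f
  constructor
  · rintro ⟨lam, ⟨h1, h2, h3⟩, rfl⟩
    have h0 : ∀ i, n ≤ i → lam i = 0 := fun i hi => eq_zero_of_sum_le h1 (h2.trans_le hi)
    exact ⟨⟨(isAntiLectureHall_iff lam).mp h1, h3, h0⟩, (hsum lam h0).symm.trans h2⟩
  · rintro ⟨⟨h1, h2, h3⟩, h4⟩
    refine ⟨Finsupp.onFinset (Finset.range n) f fun i hi =>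
      Finset.mem_range.mpr (not_le.mp fun hn => hi (h3 i hn)), ⟨?_, ?_, h2⟩, rfl⟩
    · exact (isAntiLectureHall_iff _).mpr h1
    · rw [hsum _ h3]; exact h4

lemma finite_F (m n : ℕ) : (F m n).Finite :=
  Set.Finite.of_finite_image (by rw [image_coe_F]; exact (finite_comp m n).sep _)
    DFunLike.coe_injective.injOn

lemma ncard_F (m n : ℕ) : ((F m n).ncard : ℚ) = coeff n (compGF m n) := by
  rw [coeff_compGF, ← image_coe_F, Set.ncard_image_of_injective _ DFunLike.coe_injective]

/-! ### Unfolding the multiple sum. -/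

/-- Nonincreasing `j`-tuples with entries at most `L`. -/
def antitoneTuples (j L : ℕ) : Finset (Fin j → ℕ) :=
  {N ∈ Fintype.piFinset fun _ => Finset.range (L + 1) | Antitone N}

lemma mem_antitoneTuples {j L : ℕ} {N : Fin j → ℕ} :
    N ∈ antitoneTuples j L ↔ (∀ i, N i ≤ L) ∧ Antitone N := by
  simp [antitoneTuples]

lemma cons_mem_antitoneTuples {j L M : ℕ} {N : Fin j → ℕ} :
    (Fin.cons M N : Fin (j + 1) → ℕ) ∈ antitoneTuples (j + 1) L ↔
      M ≤ L ∧ N ∈ antitoneTuples j M := by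
  simp only [mem_antitoneTuples, Fin.forall_fin_succ, Fin.cons_zero, Fin.cons_succ]
  constructor
  · rintro ⟨⟨hM, -⟩, ha⟩
    refine ⟨hM, fun i => by simpa using ha (Fin.zero_le i.succ), fun a b hab => ?_⟩
    simpa using ha (Fin.succ_le_succ_iff.mpr hab)
  · rintro ⟨hM, hN, ha⟩
    refine ⟨⟨hM, fun i => (hN i).trans hM⟩, fun a b hab => ?_⟩
    induction a using Fin.cases with
    | zero =>
      induction b using Fin.cases with
      | zero => rfl
      | succ b => simpa using hN b
    | succ a =>
      induction b using Fin.cases with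
      | zero => exact absurd hab (by simp)
      | succ b => simpa using ha (Fin.succ_le_succ_iff.mp hab)

lemma sum_antitoneTuples_succ {A : Type*} [AddCommMonoid A] (j L : ℕ)
    (φ : (Fin (j + 1) → ℕ) → A) :
    ∑ N ∈ antitoneTuples (j + 1) L, φ N =
      ∑ M ∈ Finset.range (L + 1), ∑ N ∈ antitoneTuples j M, φ (Fin.cons M N) := by
  rw [Finset.sum_sigma']
  refine Finset.sum_bij' (fun N _ => ⟨N 0, Fin.tail N⟩) (fun p _ => Fin.cons p.1 p.2)
    ?_ ?_ ?_ ?_ ?_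
  · intro N hN
    rw [← Fin.cons_self_tail N, cons_mem_antitoneTuples] at hN
    simpa [Nat.lt_succ_iff] using hN
  · rintro ⟨M, N⟩ h
    rw [cons_mem_antitoneTuples]
    simpa [Nat.lt_succ_iff] using h
  · intro N _; simp
  · rintro ⟨M, N⟩ _; simp
  · intro N _; simp

/-- The part of `summand` that involves the differences and the entries after the first. -/
noncomputable def innerTerm {j : ℕ} (N : Fin (j + 1) → ℕ) : ℚ⟦X⟧ :=
  X ^ (∑ i ∈ Finset.Icc 2 (j + 1), (entry (k := j + 2) N i) ^ 2 +
      ∑ i ∈ Finset.Icc 2 (j + 1), entry (k := j + 2) N i) *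
    (∏ i ∈ Finset.Icc 1 (j + 1), qPoch (X : ℚ⟦X⟧) X
      (entry (k := j + 2) N i - entry (k := j + 2) N (i + 1)))⁻¹

lemma entry_one {j : ℕ} (N : Fin (j + 1) → ℕ) : entry (k := j + 2) N 1 = N 0 := by
  simp [entry]

lemma summand_eq {j : ℕ} (N : Fin (j + 1) → ℕ) :
    summand (k := j + 2) N = X ^ tri (N 0) * qPoch (-X) X (N 0) * innerTerm N := by
  simp only [summand, innerTerm, show j + 2 - 1 = j + 1 from rfl, entry_one, add_assoc]
  rw [pow_add, tri]
  ring

lemma entry_cons {j M i : ℕ} (N : Fin (j + 1) → ℕ) (hi : 1 ≤ i) :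
    entry (k := j + 3) (Fin.cons M N : Fin (j + 2) → ℕ) (i + 1) = entry (k := j + 2) N i := by
  obtain ⟨i, rfl⟩ := Nat.exists_eq_add_of_le' hi
  unfold entry
  by_cases h : i < j + 1
  · rw [dif_pos (by omega), dif_pos (by omega)]
    exact Fin.cons_succ (α := fun _ => ℕ) M N ⟨i, h⟩
  · rw [dif_neg (by omega), dif_neg (by omega)]

/-- The new head `M` enters only through its difference with `N 0`, while `N 0` now contributes `N 0
^ 2 + N 0` to the exponent. -/
lemma innerTerm_cons {j M : ℕ} (N : Fin (j + 1) → ℕ) :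
    innerTerm (Fin.cons M N : Fin (j + 2) → ℕ) =
      (qPoch X X (M - N 0))⁻¹ * X ^ (2 * tri (N 0)) * innerTerm N := by
  have hI : ∀ a b : ℕ, Finset.Icc (a + 1) (b + 1) = (Finset.Icc a b).image (· + 1) := by simp
  have hS : ∀ {A : Type} [AddCommMonoid A] (φ : ℕ → A) (a b : ℕ),
      ∑ i ∈ Finset.Icc (a + 1) (b + 1), φ i = ∑ i ∈ Finset.Icc a b, φ (i + 1) := by
    intro A _ φ a b
    rw [hI, Finset.sum_image (by simp)]
  have hsq : ∑ i ∈ Finset.Icc 2 (j + 1 + 1),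
      entry (k := j + 3) (Fin.cons M N : Fin (j + 2) → ℕ) i ^ 2 =
      N 0 ^ 2 + ∑ i ∈ Finset.Icc 2 (j + 1), entry (k := j + 2) N i ^ 2 := by
    rw [hS _ 1, ← Finset.add_sum_Ioc_eq_sum_Icc (by omega : 1 ≤ j + 1),
      entry_cons N le_rfl, entry_one]
    congr 1
    refine Finset.sum_congr rfl fun i hi => ?_
    rw [entry_cons N (by have := Finset.mem_Ioc.mp hi; omega)]
  have hln : ∑ i ∈ Finset.Icc 2 (j + 1 + 1),
      entry (k := j + 3) (Fin.cons M N : Fin (j + 2) → ℕ) i =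
      N 0 + ∑ i ∈ Finset.Icc 2 (j + 1), entry (k := j + 2) N i := by
    rw [hS _ 1, ← Finset.add_sum_Ioc_eq_sum_Icc (by omega : 1 ≤ j + 1),
      entry_cons N le_rfl, entry_one]
    congr 1
    refine Finset.sum_congr rfl fun i hi => ?_
    rw [entry_cons N (by have := Finset.mem_Ioc.mp hi; omega)]
  have hpr : ∏ i ∈ Finset.Icc 1 (j + 1 + 1), qPoch (X : ℚ⟦X⟧) X
      (entry (k := j + 3) (Fin.cons M N : Fin (j + 2) → ℕ) i -
        entry (k := j + 3) (Fin.cons M N : Fin (j + 2) → ℕ) (i + 1)) =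
      qPoch X X (M - N 0) * ∏ i ∈ Finset.Icc 1 (j + 1), qPoch (X : ℚ⟦X⟧) X
        (entry (k := j + 2) N i - entry (k := j + 2) N (i + 1)) := by
    rw [← Finset.mul_prod_Ioc_eq_prod_Icc (by omega : 1 ≤ j + 1 + 1), entry_cons N le_rfl,
      entry_one, entry_one, Fin.cons_zero, ← Finset.Icc_succ_left_eq_Ioc]
    congr 1
    rw [Nat.succ_eq_succ, hI, Finset.prod_image (by simp)]
    refine Finset.prod_congr rfl fun i hi => ?_
    rw [entry_cons N (Finset.mem_Icc.mp hi).1, entry_cons N (by omega)]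
  rw [innerTerm, innerTerm, hsq, hln, hpr, PowerSeries.mul_inv_rev, two_mul_tri]
  ring

/-- Peeling off the next entry `L` works because `1 / ((q;q)_{M-L} (q;q)_L)` equals `gauss X M L /
(q;q)_M`. -/
lemma sum_innerTerm_cons (j M : ℕ) :
    ∑ N ∈ antitoneTuples j M, innerTerm (Fin.cons M N : Fin (j + 1) → ℕ) =
      (qPoch X X M)⁻¹ * innerSum j M := by
  induction j generalizing M with
  | zero =>
    have h : antitoneTuples 0 M = {Fin.elim0} := by
      ext N
      simp [mem_antitoneTuples, Subsingleton.elim N Fin.elim0, Subsingleton.antitone]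
    rw [h, Finset.sum_singleton]
    simp [innerTerm, innerSum, entry]
  | succ j ih =>
    rw [sum_antitoneTuples_succ, innerSum_succ, Finset.mul_sum]
    refine Finset.sum_congr rfl fun L hL => ?_
    simp only [innerTerm_cons, Fin.cons_zero]
    rw [← Finset.mul_sum, ih, gauss_X_eq (Nat.lt_succ_iff.mp (Finset.mem_range.mp hL))]
    linear_combination -(qPoch (X : ℚ⟦X⟧) X (M - L))⁻¹ * X ^ (2 * tri L) *
      (qPoch (X : ℚ⟦X⟧) X L)⁻¹ * innerSum j L * qPoch_X_mul_inv M

open scoped PowerSeries.WithPiTopology in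
lemma hasSum_summand (j : ℕ) (f : ℚ⟦X⟧)
    (hf : ∀ n, coeff n f = coeff n (compGF (2 * j + 2) n)) :
    HasSum (fun N : {N : Fin (j + 1) → ℕ // Antitone N} => summand (k := j + 2) N.1) f := by
  rw [PowerSeries.WithPiTopology.hasSum_iff_hasSum_coeff]
  intro n
  have hsum : coeff n f = ∑ N ∈ (antitoneTuples (j + 1) n).subtype Antitone,
      coeff n (summand (k := j + 2) N.1) := by
    rw [Finset.sum_subtype_of_mem (fun N : Fin (j + 1) → ℕ => coeff n (summand (k := j + 2) N))
      (fun N hN => (mem_antitoneTuples.mp hN).2), hf, coeff_compGF_even, ← map_sum,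
      sum_antitoneTuples_succ]
    congr 1
    refine Finset.sum_congr rfl fun M _ => ?_
    simp only [summand_eq, Fin.cons_zero]
    rw [← Finset.mul_sum, sum_innerTerm_cons]
  rw [hsum]
  -- A tuple outside the finite set has `N_1 > n`, and its summand is divisible by `X ^ tri N_1`.
  refine hasSum_sum_of_ne_finset_zero fun N hN => ?_
  have h0 : n < N.1 0 := by
    by_contra! h
    refine hN (Finset.mem_subtype.mpr (mem_antitoneTuples.mpr ⟨fun i => ?_, N.2⟩))
    exact (N.2 (Fin.zero_le i)).trans h
  rw [summand_eq, mul_assoc, coeff_X_pow_mul', if_neg (by have := le_tri (N.1 0); omega)]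

end AntiLectureHall

theorem theorem3p2 (k : ℕ) (hk : 2 ≤ k) :
    (∀ n : ℕ, (AntiLectureHall.F (2 * k - 2) n).Finite) ∧
    HasSum
      (fun N : {N : Fin (k - 1) → ℕ // Antitone N} => AntiLectureHall.summand N.1)
      (PowerSeries.mk fun n : ℕ => ((AntiLectureHall.F (2 * k - 2) n).ncard : ℚ)) := by
  obtain ⟨j, rfl⟩ := Nat.exists_eq_add_of_le' hk
  refine ⟨AntiLectureHall.finite_F _, AntiLectureHall.hasSum_summand j _ fun n => ?_⟩
  rw [PowerSeries.coeff_mk, AntiLectureHall.ncard_F]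
  rfl
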